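/- Let $k$ be an algebraically closed field of characteristic $0$. Let $S=k[x_1,x_2,x_3,x_4]$ act on $R=k[y_1,y_2,y_3,y_4]$ by partial derivation, $x_i$ acting as $\partial/\partial y_i$, and for $g\in R$ let $g^\perp=\{f\in S \mid f(g)=0\}$, which is an ideal of $S$, homogeneous when $g$ is. Let $g\in R$ be homogeneous of degree $3$. Then the following are equivalent: 1. $g^\perp$ has minimal generators in degree $3$, i.e. some minimal system of homogeneous generators of $g^\perp$ contains a form of degree $3$. 2. There exists a nonzero cubic form $\widehat g$ in three variables such that, for a suitable choice of coordinates in $R$ (that is, for some basis $y_1',y_2',y_3',y_4'$ of the space of linear forms of $R$), either $g=y_4'^3+\widehat g(y_1',y_2',y_3')$ or $g=y_3'^2y_4'+\widehat g(y_1',y_2',y_3')$. -/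

import Mathlib

namespace Apolarity

open MvPolynomial

variable {k : Type*} [Field k] {N : ℕ}

/-- The action of `S = k[x_1,…,x_N]` on `R = k[y_1,…,y_N]` by partial derivation, `x_i` acting
as `∂/∂y_i`. It is the bilinear map with
`x^α (y^β) = (∏ i, β_i (β_i - 1) ⋯ (β_i - α_i + 1)) y^(β - α) = α! (β choose α) y^(β - α)`;
the coefficient vanishes unless `α ≤ β`, so the truncated subtraction is harmless. -/
noncomputable def act :
    MvPolynomial (Fin N) k →ₗ[k] MvPolynomial (Fin N) k →ₗ[k] MvPolynomial (Fin N) k :=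
  (basisMonomials (Fin N) k).constr k fun α =>
    (basisMonomials (Fin N) k).constr k fun β =>
      monomial (β - α) (∏ i, ((β i).descFactorial (α i) : k))

theorem act_monomial (α β : Fin N →₀ ℕ) :
    act (monomial α (1 : k)) (monomial β (1 : k)) =
      monomial (β - α) (∏ i, ((β i).descFactorial (α i) : k)) := by
  have h : ∀ γ : Fin N →₀ ℕ, monomial γ (1 : k) = basisMonomials (Fin N) k γ := fun γ => by simp
  rw [h α, h β, act, Module.Basis.constr_basis, Module.Basis.constr_basis]

/-- The variable `x_i` acts as `∂/∂y_i`. -/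
theorem act_X (i : Fin N) (g : MvPolynomial (Fin N) k) : act (X i) g = pderiv i g := by
  have key : act (X i : MvPolynomial (Fin N) k) = (pderiv i).toLinearMap := by
    apply (basisMonomials (Fin N) k).ext
    intro β
    rw [coe_basisMonomials]
    change act (monomial (Finsupp.single i 1) (1 : k)) (monomial β (1 : k)) =
      pderiv i (monomial β (1 : k))
    rw [act_monomial, pderiv_monomial, one_mul]
    congr 1
    rw [Finset.prod_eq_single i]
    · simp
    · intro j _ hj
      simp [Finsupp.single_eq_of_ne hj]
    · simp
  rw [key]
  rfl

theorem act_mul (f₁ f₂ g : MvPolynomial (Fin N) k) : act (f₁ * f₂) g = act f₁ (act f₂ g) := by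
  have key : (LinearMap.mul k (MvPolynomial (Fin N) k)).compr₂ act =
      (LinearMap.mul k (Module.End k (MvPolynomial (Fin N) k))).compl₁₂ act act := by
    apply (basisMonomials (Fin N) k).ext
    intro α
    apply (basisMonomials (Fin N) k).ext
    intro β
    apply (basisMonomials (Fin N) k).ext
    intro γ
    rw [coe_basisMonomials]
    change act (monomial α (1 : k) * monomial β (1 : k)) (monomial γ (1 : k)) =
      act (monomial α (1 : k)) (act (monomial β (1 : k)) (monomial γ (1 : k)))
    rw [monomial_mul, one_mul, act_monomial, act_monomial,
      ← mul_one (∏ i, ((γ i).descFactorial (β i) : k)), ← smul_eq_mul, ← smul_monomial, map_smul,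
      act_monomial, smul_monomial, smul_eq_mul, ← Finset.prod_mul_distrib]
    refine congrArg₂ (fun a (b : k) => monomial a b) ?_ ?_
    · ext i
      simp only [Finsupp.coe_tsub, Finsupp.coe_add, Pi.sub_apply, Pi.add_apply]
      omega
    · refine Finset.prod_congr rfl fun i _ => ?_
      simp only [Finsupp.coe_tsub, Finsupp.coe_add, Pi.sub_apply, Pi.add_apply]
      rw [add_comm, ← Nat.cast_mul, ← Nat.descFactorial_mul_descFactorial (Nat.le_add_right _ _),
        Nat.add_sub_cancel_left, mul_comm]
  exact LinearMap.congr_fun (LinearMap.congr_fun (LinearMap.congr_fun key f₁) f₂) g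

/-- The apolar ideal `g^⊥ = {f ∈ S | f(g) = 0}`. -/
noncomputable def perp (g : MvPolynomial (Fin N) k) : Ideal (MvPolynomial (Fin N) k) where
  carrier := {f | act f g = 0}
  zero_mem' := by simp
  add_mem' {a b} ha hb := by
    change act (a + b) g = 0
    rw [map_add, LinearMap.add_apply, show act a g = 0 from ha, show act b g = 0 from hb, add_zero]
  smul_mem' c f hf := by
    change act (c * f) g = 0
    rw [act_mul, show act f g = 0 from hf, map_zero]

/-- `G` is a minimal system of homogeneous generators of the ideal `I`: its elements are forms,
it generates `I`, and no element of `G` can be left out. -/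
def IsMinimalHomogeneousGenerators (I : Ideal (MvPolynomial (Fin N) k))
    (G : Set (MvPolynomial (Fin N) k)) : Prop :=
  (∀ f ∈ G, ∃ n, f.IsHomogeneous n) ∧ Ideal.span G = I ∧ ∀ f ∈ G, f ∉ Ideal.span (G \ {f})

/-- The homogeneous ideal `I` has minimal generators in degree `d`: some minimal system of
homogeneous generators of `I` contains a form of degree `d`. (The number of generators of each
degree is the same for all minimal systems.) -/
def HasMinimalGeneratorInDegree (I : Ideal (MvPolynomial (Fin N) k)) (d : ℕ) : Prop :=
  ∃ G, IsMinimalHomogeneousGenerators I G ∧ ∃ f ∈ G, f.IsHomogeneous d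

/-- A choice of coordinates in `k[y_1,…,y_N]`: linear forms `ℓ_1,…,ℓ_N` that are linearly
independent (hence a basis of the space of linear forms). -/
def IsCoordinates (ℓ : Fin N → MvPolynomial (Fin N) k) : Prop :=
  (∀ i, (ℓ i).IsHomogeneous 1) ∧ LinearIndependent k ℓ

end Apolarity

/-! Write `∂_v` for the derivative along a vector `v`. By apolarity duality, a cubic generator of
`g^⊥` amounts to a cubic `h`, not a multiple of `g`, whose partial derivatives are all derivatives
of `g` (`hasMinimalGeneratorInDegree_three_iff`). Given `h`, write `∂_v h = ∂_{Av} g` for `v` in a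
complement of the vectors that kill `g`. The trilinear form of `g` sees `A` as self-adjoint, because
`∂_{Av} ∂_w g = ∂_v ∂_w h` is symmetric in `v` and `w`; and `A` is not scalar because `h` is not a
multiple of `g`. In dimension at most 4 some polynomial in `A` is a nonzero `B` of rank at most 2.
Contracting with `B u` gives quadratic forms that vanish on `ker B`, hence forms in at most two
variables, and a pencil of binary forms has a singular member. So some `∂_u g` is the square of a
nonzero linear form `b` (`exists_derivative_eq_sq`). Integrating along `u` gives the two normal
forms: if `b` does not vanish at `u`, subtract a multiple of `b^3`; if it does, subtract `b^2 v`
with `v(u) = 1`. What remains is free of the last coordinate. Conversely, the cube of `y 3`,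
respectively of `y 2`, serves as `h`. -/

/-! ### Self-adjoint operators of small rank and rank-one contractions. -/

section SelfAdjoint

variable {k W : Type*} [Field k] [AddCommGroup W] [Module k W]

/-- Polynomials in `A` stay self-adjoint, so it is enough to cut the rank by factors `A - c`. One
eigenvalue brings it to at most 3, and an eigenvalue on the range brings it to at most 2 unless the
product vanishes. -/
theorem exists_selfAdjoint_finrank_range_le_two [IsAlgClosed k] [FiniteDimensional k W]
    (hW : Module.finrank k W ≤ 4) {M : Type*} [AddCommGroup M] [Module k M]
    (T : W →ₗ[k] W →ₗ[k] M) (A : Module.End k W) (hA : ∀ v w, T (A v) w = T v (A w))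
    (hns : ∀ c : k, A ≠ c • 1) :
    ∃ B : Module.End k W, (∀ v w, T (B v) w = T v (B w)) ∧ B ≠ 0 ∧
      Module.finrank k (LinearMap.range B) ≤ 2 := by
  have hnt : Nontrivial W := by
    by_contra h
    rw [not_nontrivial_iff_subsingleton] at h
    exact hns 0 (LinearMap.ext fun x => Subsingleton.elim _ _)
  obtain ⟨l, hl⟩ := Module.End.exists_eigenvalue A
  obtain ⟨x, hx⟩ := hl.exists_hasEigenvector
  have hxA : A x = l • x := hx.apply_eq_smul
  have hx0 : x ≠ 0 := hx.2
  set C : Module.End k W := A - l • 1 with hC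
  have hCsa : ∀ c : k, ∀ v w, T ((A - c • 1) v) w = T v ((A - c • 1) w) := by
    intro c v w
    simp [hA]
  have hC0 : C ≠ 0 := fun h => hns l (sub_eq_zero.1 h)
  have hrn := LinearMap.finrank_range_add_finrank_ker C
  have hCx : C x = 0 := by simp [hC, hxA]
  have hker : 0 < Module.finrank k (LinearMap.ker C) := by
    rw [Module.finrank_pos_iff_exists_ne_zero]
    exact ⟨⟨x, hCx⟩, fun h => hx0 (congrArg Subtype.val h)⟩
  by_cases h2 : Module.finrank k (LinearMap.range C) ≤ 2
  · exact ⟨C, hCsa l, hC0, h2⟩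
  have hmaps : ∀ v ∈ LinearMap.range C, C v ∈ LinearMap.range C := fun v _ => ⟨v, rfl⟩
  have hnt' : Nontrivial (LinearMap.range C) := by
    apply Module.nontrivial_of_finrank_pos (R := k)
    omega
  obtain ⟨m, hm⟩ := Module.End.exists_eigenvalue (C.restrict hmaps)
  obtain ⟨⟨z, y, hyz⟩, hz⟩ := hm.exists_hasEigenvector
  have hz0 : z ≠ 0 := fun h => hz.2 (Subtype.ext h)
  have hCz : C z = m • z := congrArg Subtype.val hz.apply_eq_smul
  set D : Module.End k W := (C - m • 1) * C with hD
  by_cases hD0 : D = 0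
  · have hle : LinearMap.range C ≤ LinearMap.ker (C - m • 1) := by
      rintro _ ⟨v, rfl⟩
      exact LinearMap.congr_fun hD0 v
    have hf := Submodule.finrank_mono hle
    have hrn' := LinearMap.finrank_range_add_finrank_ker (C - m • 1)
    -- Here `C` has rank at least 3 and its range lies in `ker (C - m)`, so `C - m` has rank at most
    -- 1; it is nonzero because `A` is not scalar.
    refine ⟨A - (l + m) • 1, hCsa _, fun h => hns _ (sub_eq_zero.1 h), ?_⟩
    have : A - (l + m) • 1 = C - m • 1 := by rw [hC, add_smul]; abel
    rw [this]
    omega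
  · refine ⟨D, fun v w => ?_, hD0, ?_⟩
    · have h1 : ∀ v w, T ((C - m • 1) v) w = T v ((C - m • 1) w) := by
        intro v w
        simp [hC, hA]
      have hcomm : ∀ w, C ((C - m • 1) w) = (C - m • 1) (C w) := by
        intro w
        simp
      change T ((C - m • 1) (C v)) w = T v ((C - m • 1) (C w))
      rw [h1, hCsa l, hcomm]
    -- The kernel grows by `y`: `C y = z` is nonzero but killed by `C - m`. So the rank of `D` is
    -- below that of `C`, which is at most 3.
    · have hlt : LinearMap.ker C < LinearMap.ker D := by
        refine lt_of_le_of_ne (fun v hv => ?_) fun h => ?_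
        · change (C - m • 1) (C v) = 0
          rw [LinearMap.mem_ker.1 hv, map_zero]
        · have : y ∈ LinearMap.ker C := by
            rw [h]
            change (C - m • 1) (C y) = 0
            rw [hyz]
            simp [hCz]
          exact hz0 (hyz ▸ this)
      have hf := Submodule.finrank_lt_finrank_of_lt hlt
      have hrn' := LinearMap.finrank_range_add_finrank_ker D
      omega

theorem exists_singular_of_binary_pencil [IsAlgClosed k] (a b c : k) :
    ∃ s t : k, (s ≠ 0 ∨ t ≠ 0) ∧ a * s ^ 2 + b * s * t + c * t ^ 2 = 0 := by
  by_cases ha : a = 0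
  · exact ⟨1, 0, Or.inl one_ne_zero, by simp [ha]⟩
  · have hdeg : (Polynomial.C a * Polynomial.X ^ 2 + Polynomial.C b * Polynomial.X +
        Polynomial.C c).degree ≠ 0 := by
      rw [Polynomial.degree_quadratic ha]
      decide
    obtain ⟨s, hs⟩ := IsAlgClosed.exists_root _ hdeg
    refine ⟨s, 1, Or.inr one_ne_zero, ?_⟩
    simpa [Polynomial.IsRoot] using hs

/-- A singular symmetric 2×2 matrix is an outer square: square roots of the diagonal entries give
the off-diagonal entry up to a sign, absorbed in `β`. -/
theorem exists_mul_self_of_singular [IsAlgClosed k] (p q r : k) (h : p * r = q ^ 2) :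
    ∃ α β : k, α * α = p ∧ α * β = q ∧ β * β = r := by
  obtain ⟨α, hα⟩ := IsAlgClosed.exists_pow_nat_eq p (n := 2) (by norm_num)
  obtain ⟨β, hβ⟩ := IsAlgClosed.exists_pow_nat_eq r (n := 2) (by norm_num)
  have h1 : (α * β - q) * (α * β + q) = 0 := by
    linear_combination β ^ 2 * hα + p * hβ + h
  rcases mul_eq_zero.1 h1 with h2 | h2
  · exact ⟨α, β, by rw [← hα]; ring, by linear_combination h2, by rw [← hβ]; ring⟩
  · exact ⟨α, -β, by rw [← hα]; ring, by linear_combination -h2, by rw [← hβ]; ring⟩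

/-- A trilinear form with a non-scalar self-adjoint operator on a space of dimension at most four
has a contraction of rank at most one. -/
theorem exists_contraction_eq_mul [IsAlgClosed k] [FiniteDimensional k W]
    (hW : Module.finrank k W ≤ 4) (T : W →ₗ[k] W →ₗ[k] W →ₗ[k] k)
    (hT : ∀ u v w, T u v w = T u w v) (A : Module.End k W)
    (hA : ∀ v w, T (A v) w = T v (A w)) (hns : ∀ c : k, A ≠ c • 1) :
    ∃ (u : W) (L : W →ₗ[k] k), u ≠ 0 ∧ ∀ v w, T u v w = L v * L w := by
  obtain ⟨B, hB, hB0, hr⟩ := exists_selfAdjoint_finrank_range_le_two hW T A hA hns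
  -- Each form `T (B u)` descends to `W / ker B`, which is identified with the range of `B`.
  have hker : ∀ u v, B v = 0 → T (B u) v = 0 := by
    intro u v hv
    rw [hB, hv, map_zero]
  have hpos : 0 < Module.finrank k (LinearMap.range B) := by
    rw [Module.finrank_pos_iff_exists_ne_zero]
    by_contra! h
    exact hB0 (LinearMap.ext fun x => congrArg Subtype.val (h ⟨B x, x, rfl⟩))
  obtain ⟨n, b, hcases⟩ : ∃ (n : ℕ) (_ : Module.Basis (Fin n) k (LinearMap.range B)),
      n = 1 ∨ n = 2 := ⟨_, Module.finBasis k _, by omega⟩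
  choose e he using fun i => (b i).2
  let φ : Fin n → W →ₗ[k] k := fun i => b.coord i ∘ₗ B.rangeRestrict
  have hdec : ∀ v, B (v - ∑ i, φ i v • e i) = 0 := by
    intro v
    have h1 := congrArg Subtype.val (b.sum_repr (B.rangeRestrict v))
    simp only [map_sub, map_sum, map_smul, he]
    rw [sub_eq_zero]
    rw [Submodule.coe_sum] at h1
    exact h1.symm
  have hexp1 : ∀ u v w, T (B u) v w = ∑ i, φ i v * T (B u) (e i) w := by
    intro u v w
    have h1 := LinearMap.congr_fun (hker u _ (hdec v)) w
    rw [map_sub, LinearMap.sub_apply, LinearMap.zero_apply, sub_eq_zero] at h1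
    rw [h1]
    simp
  have hexp : ∀ u v w, T (B u) v w = ∑ i, ∑ j, φ i v * φ j w * T (B u) (e i) (e j) := by
    intro u v w
    rw [hexp1]
    refine Finset.sum_congr rfl fun i _ => ?_
    rw [hT, hexp1, Finset.mul_sum]
    refine Finset.sum_congr rfl fun j _ => ?_
    rw [hT _ (e j)]
    ring
  have hbne : ∀ i, B (e i) ≠ 0 := by
    intro i h
    rw [he] at h
    exact b.ne_zero i (Subtype.ext h)
  rcases hcases with rfl | rfl
  · obtain ⟨α, hα⟩ := IsAlgClosed.exists_pow_nat_eq (T (B (e 0)) (e 0) (e 0)) (n := 2) (by norm_num)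
    refine ⟨B (e 0), α • φ 0, hbne 0, fun v w => ?_⟩
    rw [hexp]
    simp [← hα]
    ring
  · set Q : Fin 2 → Fin 2 → Fin 2 → k := fun l i j => T (B (e l)) (e i) (e j) with hQ
    -- The three coefficients passed next are those of the determinant of `s Q 0 + t Q 1` as a form
    -- in `s, t`.
    have hQs : ∀ l, Q l 1 0 = Q l 0 1 := fun l => hT _ _ _
    obtain ⟨s, t, hst, hdet⟩ := exists_singular_of_binary_pencil
      (Q 0 0 0 * Q 0 1 1 - Q 0 0 1 ^ 2)
      (Q 0 0 0 * Q 1 1 1 + Q 1 0 0 * Q 0 1 1 - 2 * Q 0 0 1 * Q 1 0 1)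
      (Q 1 0 0 * Q 1 1 1 - Q 1 0 1 ^ 2)
    obtain ⟨α, β, h1, h2, h3⟩ := exists_mul_self_of_singular (s * Q 0 0 0 + t * Q 1 0 0)
      (s * Q 0 0 1 + t * Q 1 0 1) (s * Q 0 1 1 + t * Q 1 1 1) (by linear_combination hdet)
    refine ⟨B (s • e 0 + t • e 1), α • φ 0 + β • φ 1, fun h => ?_, fun v w => ?_⟩
    · have h0 : ∑ i, ![s, t] i • b i = 0 := by
        apply Subtype.ext
        simpa [he] using h
      have h1 := Fintype.linearIndependent_iff.1 b.linearIndependent _ h0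
      exact hst.elim (fun hs => hs (h1 0)) (fun ht => ht (h1 1))
    · rw [hexp]
      have hTu : ∀ i j, T (B (s • e 0 + t • e 1)) (e i) (e j) = s * Q 0 i j + t * Q 1 i j := by
        intro i j
        simp [hQ]
      simp only [Fin.sum_univ_two, hTu, hQs, LinearMap.add_apply, LinearMap.smul_apply, smul_eq_mul]
      linear_combination -(φ 0 v * φ 0 w) * h1 - (φ 0 v * φ 1 w + φ 1 v * φ 0 w) * h2 -
        (φ 1 v * φ 1 w) * h3

end SelfAdjoint

namespace Apolarity

open MvPolynomial

/-! ### The apolarity pairing. -/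

section Pairing

variable {k : Type*} [Field k] {N : ℕ}

theorem act_comm (f₁ f₂ g : MvPolynomial (Fin N) k) : act f₁ (act f₂ g) = act f₂ (act f₁ g) := by
  rw [← act_mul, ← act_mul, mul_comm]

theorem act_C (a : k) (g : MvPolynomial (Fin N) k) : act (C a) g = C a * g := by
  have key : act (1 : MvPolynomial (Fin N) k) = LinearMap.id := by
    apply (basisMonomials (Fin N) k).ext
    intro β
    rw [coe_basisMonomials]
    change act (monomial 0 (1 : k)) (monomial β (1 : k)) = _
    rw [act_monomial]
    simp
  have h : (C a : MvPolynomial (Fin N) k) = a • 1 := by rw [smul_eq_C_mul, mul_one]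
  rw [h, map_smul, LinearMap.smul_apply, key, LinearMap.id_apply, smul_mul_assoc, one_mul]

theorem act_monomial_monomial (α β : Fin N →₀ ℕ) (a b : k) :
    act (monomial α a) (monomial β b) =
      (a * b) • monomial (β - α) (∏ i, ((β i).descFactorial (α i) : k)) := by
  have h : ∀ (γ : Fin N →₀ ℕ) (c : k), monomial γ c = c • monomial γ (1 : k) := fun γ c => by
    rw [smul_monomial, smul_eq_mul, mul_one]
  rw [h α a, h β b, map_smul, map_smul, LinearMap.smul_apply, act_monomial, smul_smul, mul_comm]

theorem degree_eq_of_mem_support {n : ℕ} {f : MvPolynomial (Fin N) k} (hf : f.IsHomogeneous n)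
    {α : Fin N →₀ ℕ} (hα : α ∈ f.support) : n = α.degree :=
  hf.degree_eq_sum_deg_support hα

theorem prod_descFactorial_eq_zero {α β : Fin N →₀ ℕ} (h : ¬ α ≤ β) :
    (∏ i, ((β i).descFactorial (α i) : k)) = 0 := by
  obtain ⟨i, hi⟩ : ∃ i, β i < α i := by simpa [Finsupp.le_def] using h
  apply Finset.prod_eq_zero (Finset.mem_univ i)
  rw [Nat.descFactorial_eq_zero_iff_lt.2 hi, Nat.cast_zero]

theorem isHomogeneous_act_monomial {α : Fin N →₀ ℕ} {n : ℕ} (a : k)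
    {g : MvPolynomial (Fin N) k} (hg : g.IsHomogeneous n) :
    (act (monomial α a) g).IsHomogeneous (n - α.degree) := by
  rw [g.as_sum, map_sum]
  apply IsHomogeneous.sum
  intro β hβ
  have hdeg := degree_eq_of_mem_support hg hβ
  rw [act_monomial_monomial]
  by_cases h : α ≤ β
  · rw [smul_monomial]
    apply isHomogeneous_monomial
    rw [hdeg]
    obtain ⟨γ, rfl⟩ := exists_add_of_le h
    rw [map_add, add_tsub_cancel_left, add_tsub_cancel_left]
  · rw [prod_descFactorial_eq_zero h, map_zero, smul_zero]
    exact isHomogeneous_zero _ _ _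

theorem isHomogeneous_act {m n : ℕ} {f g : MvPolynomial (Fin N) k} (hf : f.IsHomogeneous m)
    (hg : g.IsHomogeneous n) : (act f g).IsHomogeneous (n - m) := by
  rw [f.as_sum, map_sum, LinearMap.sum_apply]
  apply IsHomogeneous.sum
  intro α hα
  have hdeg := degree_eq_of_mem_support hf hα
  rw [hdeg]
  exact isHomogeneous_act_monomial _ hg

theorem act_eq_zero_of_lt {m n : ℕ} {f g : MvPolynomial (Fin N) k} (hf : f.IsHomogeneous m)
    (hg : g.IsHomogeneous n) (h : n < m) : act f g = 0 := by
  rw [f.as_sum, map_sum, LinearMap.sum_apply]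
  refine Finset.sum_eq_zero fun α hα => ?_
  rw [g.as_sum, map_sum]
  refine Finset.sum_eq_zero fun β hβ => ?_
  rw [act_monomial_monomial, prod_descFactorial_eq_zero, map_zero, smul_zero]
  intro hle
  have h1 := degree_eq_of_mem_support hf hα
  have h2 := degree_eq_of_mem_support hg hβ
  have h3 := Finsupp.degree_mono hle
  omega

theorem act_monomial_of_degree_eq {α β : Fin N →₀ ℕ} (h : α.degree = β.degree) (a b : k) :
    act (monomial α a) (monomial β b) =
      if α = β then C (a * b * ∏ i, ((α i).factorial : k)) else 0 := by
  rw [act_monomial_monomial]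
  split_ifs with hαβ
  · subst hαβ
    simp [Nat.descFactorial_self, smul_eq_C_mul, ← C_apply]
  · rw [prod_descFactorial_eq_zero, map_zero, smul_zero]
    intro hle
    obtain ⟨γ, rfl⟩ := exists_add_of_le hle
    rw [map_add] at h
    have : γ.degree = 0 := by omega
    rw [Finsupp.degree_eq_zero_iff] at this
    exact hαβ (by rw [this, add_zero])

theorem act_symm {n : ℕ} {f g : MvPolynomial (Fin N) k} (hf : f.IsHomogeneous n)
    (hg : g.IsHomogeneous n) : act f g = act g f := by
  rw [f.as_sum, map_sum, LinearMap.sum_apply, map_sum]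
  refine Finset.sum_congr rfl fun α hα => ?_
  rw [g.as_sum, map_sum, map_sum, LinearMap.sum_apply]
  refine Finset.sum_congr rfl fun β hβ => ?_
  have h : α.degree = β.degree :=
    (degree_eq_of_mem_support hf hα).symm.trans (degree_eq_of_mem_support hg hβ)
  rw [act_monomial_of_degree_eq h, act_monomial_of_degree_eq h.symm]
  by_cases hαβ : α = β
  · subst hαβ
    simp [mul_comm]
  · rw [if_neg hαβ, if_neg (Ne.symm hαβ)]

variable [CharZero k]

/-- In a fixed degree, monomials are orthogonal for the pairing, with squares `α!`, invertible in
characteristic 0. -/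
theorem exists_act_eq_C (n : ℕ) (l : MvPolynomial (Fin N) k →ₗ[k] k) :
    ∃ p : MvPolynomial (Fin N) k, p.IsHomogeneous n ∧
      ∀ q : MvPolynomial (Fin N) k, q.IsHomogeneous n → act p q = C (l q) := by
  classical
  refine ⟨∑ α ∈ Finset.finsuppAntidiag Finset.univ n,
    monomial α (l (monomial α 1) / ∏ i, ((α i).factorial : k)), ?_, fun q hq => ?_⟩
  · apply IsHomogeneous.sum
    intro α hα
    apply isHomogeneous_monomial
    rw [Finset.mem_finsuppAntidiag] at hα
    rw [Finsupp.degree_eq_sum]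
    exact hα.1
  · conv_lhs => rw [q.as_sum]
    conv_rhs => rw [q.as_sum]
    rw [map_sum (act _), map_sum l, map_sum C]
    refine Finset.sum_congr rfl fun β hβ => ?_
    have hdeg : β.degree = n := (degree_eq_of_mem_support hq hβ).symm
    have hmem : β ∈ Finset.finsuppAntidiag (Finset.univ : Finset (Fin N)) n := by
      rw [Finset.mem_finsuppAntidiag, ← Finsupp.degree_eq_sum]
      exact ⟨hdeg, Finset.subset_univ _⟩
    rw [map_sum, LinearMap.sum_apply, Finset.sum_eq_single β]
    · rw [act_monomial_of_degree_eq rfl, if_pos rfl]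
      congr 1
      have h0 : (∏ i, ((β i).factorial : k)) ≠ 0 :=
        Finset.prod_ne_zero_iff.2 fun i _ => Nat.cast_ne_zero.2 (Nat.factorial_ne_zero _)
      rw [← mul_one (coeff β q), ← smul_eq_mul (coeff β q), ← smul_monomial, map_smul, smul_eq_mul,
        smul_eq_mul]
      field_simp
    · intro α hα hne
      rw [Finset.mem_finsuppAntidiag, ← Finsupp.degree_eq_sum] at hα
      rw [act_monomial_of_degree_eq (hα.1.trans hdeg.symm), if_neg hne]
    · exact fun h => absurd hmem h

/-- Forms of degree `n` are separated from subspaces by the apolarity pairing. -/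
theorem exists_separating_form {n : ℕ} {h : MvPolynomial (Fin N) k} (hh : h.IsHomogeneous n)
    {U : Submodule k (MvPolynomial (Fin N) k)} (hU : h ∉ U) :
    ∃ p : MvPolynomial (Fin N) k, p.IsHomogeneous n ∧ act p h ≠ 0 ∧
      ∀ q ∈ U, q.IsHomogeneous n → act p q = 0 := by
  obtain ⟨l, hl, hUl⟩ := Submodule.exists_le_ker_of_notMem hU
  obtain ⟨p, hp, hpl⟩ := exists_act_eq_C n l
  refine ⟨p, hp, ?_, fun q hq hqn => ?_⟩
  · rw [hpl h hh, Ne, C_eq_zero]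
    exact hl
  · rw [hpl q hqn, LinearMap.mem_ker.1 (hUl hq), C_0]

/-- Euler's identity recovers a form of positive degree from its partial derivatives. -/
theorem eq_of_pderiv_eq {n : ℕ} (hn : n ≠ 0) {p q : MvPolynomial (Fin N) k}
    (hp : p.IsHomogeneous n) (hq : q.IsHomogeneous n) (h : ∀ i, pderiv i p = pderiv i q) :
    p = q := by
  have h1 := hp.sum_X_mul_pderiv
  have h2 := hq.sum_X_mul_pderiv
  simp only [h] at h1
  rw [h2, nsmul_eq_mul, nsmul_eq_mul] at h1
  exact (mul_left_cancel₀ (Nat.cast_ne_zero.2 hn) h1).symm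

end Pairing

/-! ### Linear forms as directional derivatives. -/

section LinearForm

variable {k : Type*} [Field k] {N : ℕ}

/-- The linear form with the given coefficients. -/
noncomputable def linearForm : (Fin N → k) →ₗ[k] MvPolynomial (Fin N) k :=
  Fintype.linearCombination k X

theorem linearForm_apply (a : Fin N → k) :
    linearForm a = ∑ i, a i • (X i : MvPolynomial (Fin N) k) := rfl

theorem isHomogeneous_linearForm (a : Fin N → k) : (linearForm a).IsHomogeneous 1 := by
  rw [linearForm_apply]
  apply IsHomogeneous.sum
  intro i _
  rw [smul_eq_C_mul]
  exact isHomogeneous_C_mul_X _ _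

theorem linearForm_single (i : Fin N) :
    linearForm (Pi.single i 1) = (X i : MvPolynomial (Fin N) k) := by
  rw [linearForm, Fintype.linearCombination_apply_single, one_smul]

theorem act_linearForm (a : Fin N → k) (p : MvPolynomial (Fin N) k) :
    act (linearForm a) p = ∑ i, a i • pderiv i p := by
  rw [linearForm_apply, map_sum, LinearMap.sum_apply]
  simp [act_X]

theorem act_linearForm_mul (a : Fin N → k) (p q : MvPolynomial (Fin N) k) :
    act (linearForm a) (p * q) = act (linearForm a) p * q + p * act (linearForm a) q := by
  simp only [act_linearForm, pderiv_mul, smul_add, Finset.sum_add_distrib, Finset.sum_mul,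
    Finset.mul_sum, smul_mul_assoc, mul_smul_comm]

theorem act_linearForm_linearForm (a b : Fin N → k) :
    act (linearForm a) (linearForm b) = C (a ⬝ᵥ b) := by
  classical
  rw [act_linearForm]
  simp [linearForm_apply, pderiv_X, dotProduct, Pi.single_apply, smul_eq_C_mul]

theorem pderiv_linearForm (i : Fin N) (b : Fin N → k) : pderiv i (linearForm b) = C (b i) := by
  rw [← act_X, ← linearForm_single, act_linearForm_linearForm, single_one_dotProduct]

theorem exists_eq_linearForm {p : MvPolynomial (Fin N) k} (hp : p.IsHomogeneous 1) :
    ∃ a, p = linearForm a := by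
  have h : p ∈ homogeneousSubmodule (Fin N) k 1 := hp
  rw [homogeneousSubmodule_one_eq_span_X, Submodule.mem_span_range_iff_exists_fun] at h
  obtain ⟨a, ha⟩ := h
  exact ⟨a, ha.symm⟩

theorem linearForm_injective : Function.Injective (linearForm (k := k) (N := N)) := by
  intro a b hab
  ext i
  have := congrArg (pderiv i) hab
  rwa [pderiv_linearForm, pderiv_linearForm, C_inj] at this

end LinearForm

/-! ### Minimal generators and degrees. -/

section MinimalGenerators

variable {k : Type*} [Field k] {N : ℕ}

theorem exists_isMinimalHomogeneousGenerators {I : Ideal (MvPolynomial (Fin N) k)}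
    (hI : Ideal.span {f | f ∈ I ∧ ∃ n, f.IsHomogeneous n} = I) :
    ∃ G, IsMinimalHomogeneousGenerators I G := by
  classical
  obtain ⟨s, hs, hspan⟩ := (Submodule.fg_span_iff_fg_span_finset_subset _).1
    (IsNoetherian.noetherian (Ideal.span {f | f ∈ I ∧ ∃ n, f.IsHomogeneous n}))
  let P : Finset (MvPolynomial (Fin N) k) → Prop := fun t =>
    t ⊆ s ∧ Ideal.span (t : Set (MvPolynomial (Fin N) k)) = I
  have hPs : P s := ⟨subset_rfl, hspan.symm.trans hI⟩
  obtain ⟨t, ht⟩ := exists_minimal_of_wellFoundedLT P ⟨s, hPs⟩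
  refine ⟨t, fun f hf => (hs (ht.prop.1 hf)).2, ht.prop.2, fun f hf hmem => ?_⟩
  have herase : P (t.erase f) := by
    refine ⟨(Finset.erase_subset _ _).trans ht.prop.1, ?_⟩
    rw [← ht.prop.2]
    apply le_antisymm (Ideal.span_mono (Finset.coe_subset.2 (Finset.erase_subset _ _)))
    rw [Ideal.span_le]
    intro q hq
    by_cases hqf : q = f
    · rw [hqf, Finset.coe_erase]
      exact hmem
    · exact Ideal.subset_span (Finset.mem_coe.2 (Finset.mem_erase.2 ⟨hqf, hq⟩))
  exact Finset.notMem_erase f t (ht.le_of_le herase (Finset.erase_subset _ _) hf)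

theorem homogeneousComponent_mem_perp {d : ℕ} {g : MvPolynomial (Fin N) k}
    (hg : g.IsHomogeneous d) {f : MvPolynomial (Fin N) k} (hf : f ∈ perp g) (n : ℕ) :
    homogeneousComponent n f ∈ perp g := by
  change act _ g = 0
  -- Components of degree above `d` kill `g` outright. They must be set aside because the degree `d
  -- - n` is truncated and would no longer determine `n`.
  by_cases hn : d < n
  · exact act_eq_zero_of_lt (homogeneousComponent_isHomogeneous n f) hg hn
  have h0 : homogeneousComponent (d - n) (act f g) = 0 := by
    rw [show act f g = 0 from hf, map_zero]
  rw [← sum_homogeneousComponent f, map_sum, LinearMap.sum_apply, map_sum,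
    Finset.sum_eq_single n] at h0
  · rwa [homogeneousComponent_eq_self (isHomogeneous_act
      (homogeneousComponent_isHomogeneous n f) hg)] at h0
  · intro m _ hmn
    by_cases hm : d < m
    · rw [act_eq_zero_of_lt (homogeneousComponent_isHomogeneous m f) hg hm, map_zero]
    · rw [homogeneousComponent_of_mem (isHomogeneous_act
        (homogeneousComponent_isHomogeneous m f) hg), if_neg (by omega)]
  · intro hnm
    rw [Finset.mem_range, not_lt] at hnm
    rw [homogeneousComponent_eq_zero n f (by omega), map_zero, LinearMap.zero_apply, map_zero]

theorem span_homogeneous_perp {d : ℕ} {g : MvPolynomial (Fin N) k} (hg : g.IsHomogeneous d) :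
    Ideal.span {f | f ∈ perp g ∧ ∃ n, f.IsHomogeneous n} = perp g := by
  apply le_antisymm
  · rw [Ideal.span_le]
    exact fun f hf => hf.1
  · intro f hf
    rw [← sum_homogeneousComponent f]
    exact Ideal.sum_mem _ fun n _ => Ideal.subset_span
      ⟨homogeneousComponent_mem_perp hg hf n, n, homogeneousComponent_isHomogeneous n f⟩

theorem homogeneousComponent_mem_span {G : Set (MvPolynomial (Fin N) k)}
    (hG : ∀ f ∈ G, ∃ n, f.IsHomogeneous n) {p : MvPolynomial (Fin N) k} (hp : p ∈ Ideal.span G)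
    (n : ℕ) : homogeneousComponent n p ∈ Ideal.span G := by
  let _ : GradedAlgebra (homogeneousSubmodule (Fin N) k) := MvPolynomial.gradedAlgebra
  exact homogeneousComponent_mem_of_mem (Ideal.homogeneous_span _ _ hG) hp n

theorem homogeneousComponent_mul_eq_zero {m n : ℕ} (h : n < m) {f : MvPolynomial (Fin N) k}
    (hf : f.IsHomogeneous m) (a : MvPolynomial (Fin N) k) :
    homogeneousComponent n (a * f) = 0 := by
  rw [← sum_homogeneousComponent a, Finset.sum_mul, map_sum]
  refine Finset.sum_eq_zero fun i _ => ?_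
  rw [homogeneousComponent_of_mem ((homogeneousComponent_isHomogeneous i a).mul hf),
    if_neg (by omega)]

/-- Omitting a generator of degree `m` does not affect the forms of degree less than `m`. -/
theorem mem_span_diff_of_lt {G : Set (MvPolynomial (Fin N) k)}
    (hG : ∀ f ∈ G, ∃ n, f.IsHomogeneous n) {f : MvPolynomial (Fin N) k} {m n : ℕ}
    (hf : f.IsHomogeneous m) {p : MvPolynomial (Fin N) k} (hp : p.IsHomogeneous n) (h : n < m)
    (hpG : p ∈ Ideal.span G) : p ∈ Ideal.span (G \ {f}) := by
  have h1 : p ∈ Ideal.span (G \ {f}) ⊔ Ideal.span {f} := by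
    rw [← Ideal.span_union]
    exact Ideal.span_mono (by simp) hpG
  obtain ⟨q, hq, r, hr, hqr⟩ := Submodule.mem_sup.1 h1
  obtain ⟨a, rfl⟩ := Ideal.mem_span_singleton'.1 hr
  have h2 := homogeneousComponent_mem_span (fun f hf => hG f hf.1) hq n
  rwa [← add_zero (homogeneousComponent n q), ← homogeneousComponent_mul_eq_zero h hf a, ← map_add,
    hqr, homogeneousComponent_eq_self hp] at h2

end MinimalGenerators

/-! ### Cubic generators and cubics with derivatives among those of `g`. -/

section Criterion

variable {k : Type*} [Field k] {N : ℕ}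

/-- Since `x_i q` sends `h` to `q (∂_a g) = ∂_a (q g) = 0`, only the constant term of `c` matters.
Hence a functional that kills generators of `g^⊥` kills all of it. -/
theorem constantCoeff_act_mul {g h : MvPolynomial (Fin N) k}
    (hd : ∀ i, ∃ a, pderiv i h = act (linearForm a) g) {q : MvPolynomial (Fin N) k}
    (hq : q ∈ perp g) (c : MvPolynomial (Fin N) k) :
    constantCoeff (act (c * q) h) = constantCoeff c * constantCoeff (act q h) := by
  induction c using MvPolynomial.induction_on with
  | C a => rw [act_mul, act_C, map_mul]
  | add p r hp hr => rw [add_mul, map_add, LinearMap.add_apply, map_add, hp, hr, map_add, add_mul]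
  | mul_X p i _ =>
    obtain ⟨a, ha⟩ := hd i
    rw [mul_assoc, act_mul, mul_comm (X i), act_mul, act_X, ha, act_comm q,
      show act q g = 0 from hq]
    simp

/-- The apolar ideal of a cubic form `g` has minimal generators in degree three if and only if
some cubic form that is not a multiple of `g` has all its partial derivatives among the
derivatives of `g`. -/
theorem hasMinimalGeneratorInDegree_three_iff [CharZero k] {g : MvPolynomial (Fin N) k}
    (hg : g.IsHomogeneous 3) :
    HasMinimalGeneratorInDegree (perp g) 3 ↔
      ∃ h : MvPolynomial (Fin N) k, h.IsHomogeneous 3 ∧ h ∉ Submodule.span k {g} ∧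
        ∀ i, ∃ a, pderiv i h = act (linearForm a) g := by
  constructor
  · rintro ⟨G, ⟨hGh, hGI, hmin⟩, f, hfG, hf⟩
    have hfg : act f g = 0 := by
      have : f ∈ perp g := hGI ▸ Ideal.subset_span hfG
      exact this
    -- By minimality `f` is outside the ideal of the other generators; `h` is a cubic dual to that
    -- fact.
    obtain ⟨h, hh, hfh, hJ⟩ := exists_separating_form hf
      (U := (Ideal.span (G \ {f})).restrictScalars k) (hmin f hfG)
    refine ⟨h, hh, fun hspan => ?_, fun i => ?_⟩
    · obtain ⟨c, rfl⟩ := Submodule.mem_span_singleton.1 hspan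
      apply hfh
      rw [act_symm hh hf, map_smul, hfg, smul_zero]
    · by_contra! hcon
      have hnot : pderiv i h ∉ LinearMap.range ((act.flip g) ∘ₗ linearForm) := by
        rintro ⟨a, ha⟩
        exact hcon a ha.symm
      obtain ⟨p, hp, hpi, hpg⟩ := exists_separating_form (hh.pderiv (i := i)) hnot
      have hder : ∀ a, act p (act (linearForm a) g) = 0 := fun a =>
        hpg _ ⟨a, rfl⟩ (isHomogeneous_act (isHomogeneous_linearForm a) hg)
      have hpI : p ∈ perp g := by
        refine eq_of_pderiv_eq one_ne_zero (isHomogeneous_act hp hg) (isHomogeneous_zero _ _ _)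
          fun j => ?_
        rw [← act_X, act_comm, ← linearForm_single, hder, map_zero]
      -- A quadric in `g^⊥` never needs the cubic `f`, so `x_i p` is in the smaller ideal and
      -- annihilates `h`.
      have hpJ : p ∈ Ideal.span (G \ {f}) :=
        mem_span_diff_of_lt hGh hf hp (by norm_num) (hGI.symm ▸ hpI)
      have hX : (X i * p).IsHomogeneous 3 := (isHomogeneous_X k i).mul hp
      have h1 := hJ (X i * p) (Ideal.mul_mem_left _ _ hpJ) hX
      rw [act_symm hh hX, act_mul, act_comm, act_X] at h1
      exact hpi h1
  · rintro ⟨h, hh, hspan, hd⟩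
    obtain ⟨f, hf, hfh, hfg⟩ := exists_separating_form hh hspan
    have hfI : f ∈ perp g := hfg g (Submodule.mem_span_singleton_self g) hg
    obtain ⟨G, hG⟩ := exists_isMinimalHomogeneousGenerators (span_homogeneous_perp hg)
    refine ⟨G, hG, ?_⟩
    obtain ⟨hGh, hGI, -⟩ := hG
    by_contra! hcon
    have hzero : ∀ q ∈ G, constantCoeff (act q h) = 0 := by
      intro q hq
      obtain ⟨n, hn⟩ := hGh q hq
      rcases lt_trichotomy n 3 with hlt | rfl | hlt
      · exact (isHomogeneous_act hn hh).coeff_eq_zero (by simp; omega)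
      · exact absurd hn (hcon q hq)
      · rw [act_eq_zero_of_lt hn hh hlt, map_zero]
    have hall : ∀ p ∈ Ideal.span G, constantCoeff (act p h) = 0 := by
      intro p hp
      induction hp using Submodule.span_induction with
      | mem q hq => exact hzero q hq
      | zero => simp
      | add p q _ _ hp hq => rw [map_add, LinearMap.add_apply, map_add, hp, hq, add_zero]
      | smul c q hq ih =>
        have hqI : q ∈ perp g := hGI ▸ hq
        rw [smul_eq_mul, constantCoeff_act_mul hd hqI, ih, mul_zero]
    have h0 := isHomogeneous_act hf hh
    rw [Nat.sub_self, ← totalDegree_zero_iff_isHomogeneous, totalDegree_eq_zero_iff_eq_C] at h0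
    apply hfh
    rw [h0, ← constantCoeff_eq, hall f (hGI.symm ▸ hfI), C_0]

end Criterion

/-! ### Linear changes of coordinates. -/

section Substitution

open scoped Matrix

variable {k : Type*} [Field k] {N : ℕ}

/-- The linear change of variables whose `i`-th coordinate is the linear form with coefficients
the `i`-th row of `M`. -/
noncomputable def linearSubst (M : Matrix (Fin N) (Fin N) k) :
    MvPolynomial (Fin N) k →ₐ[k] MvPolynomial (Fin N) k :=
  aeval fun i => linearForm (M i)

theorem linearSubst_X (M : Matrix (Fin N) (Fin N) k) (i : Fin N) :
    linearSubst M (X i) = linearForm (M i) := aeval_X _ _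

theorem linearSubst_linearForm (M : Matrix (Fin N) (Fin N) k) (a : Fin N → k) :
    linearSubst M (linearForm a) = linearForm (a ᵥ* M) := by
  rw [linearForm_apply a, map_sum, Matrix.vecMul_eq_sum, map_sum]
  simp [linearSubst_X]

theorem linearSubst_comp_of_mul_eq_one {M M' : Matrix (Fin N) (Fin N) k} (h : M' * M = 1)
    (p : MvPolynomial (Fin N) k) : linearSubst M (linearSubst M' p) = p := by
  have key : (linearSubst M).comp (linearSubst M') = AlgHom.id k _ := by
    apply algHom_ext
    intro i
    have hi : M' i ᵥ* M = Pi.single i 1 := by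
      rw [← Matrix.mul_apply_eq_vecMul, h]
      ext j
      simp [Matrix.one_apply, Pi.single_apply, eq_comm]
    rw [AlgHom.comp_apply, linearSubst_X, linearSubst_linearForm, hi, linearForm_single]
    rfl
  exact DFunLike.congr_fun key p

theorem linearSubst_injective {M : Matrix (Fin N) (Fin N) k} (hM : IsUnit M) :
    Function.Injective (linearSubst M) := by
  obtain ⟨M', hM'⟩ := hM.exists_right_inv
  exact Function.LeftInverse.injective (linearSubst_comp_of_mul_eq_one hM')

theorem isHomogeneous_linearSubst (M : Matrix (Fin N) (Fin N) k) {n : ℕ}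
    {p : MvPolynomial (Fin N) k} (hp : p.IsHomogeneous n) :
    (linearSubst M p).IsHomogeneous n := by
  have h := hp.aeval (n := 1) (fun i => linearForm (M i)) fun i => isHomogeneous_linearForm _
  rwa [one_mul] at h

theorem exists_linearSubst_eq {M : Matrix (Fin N) (Fin N) k} (hM : IsUnit M) {n : ℕ}
    {f : MvPolynomial (Fin N) k} (hf : f.IsHomogeneous n) :
    ∃ p : MvPolynomial (Fin N) k, p.IsHomogeneous n ∧ linearSubst M p = f := by
  obtain ⟨M', hM'⟩ := hM.exists_left_inv
  exact ⟨linearSubst M' f, isHomogeneous_linearSubst M' hf, linearSubst_comp_of_mul_eq_one hM' f⟩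

theorem act_linearForm_linearSubst (M : Matrix (Fin N) (Fin N) k) (u : Fin N → k)
    (p : MvPolynomial (Fin N) k) :
    act (linearForm u) (linearSubst M p) = linearSubst M (act (linearForm (M *ᵥ u)) p) := by
  induction p using MvPolynomial.induction_on with
  | C a => simp [linearSubst, act_linearForm]
  | add p q hp hq => simp only [map_add, hp, hq]
  | mul_X p i ih =>
    have hX : act (linearForm (M *ᵥ u)) (X i) = C ((M *ᵥ u) i) := by
      rw [← linearForm_single, act_linearForm_linearForm, dotProduct_single_one]
    have hC : ∀ a : k, linearSubst M (C a) = C a := fun a => by simp [linearSubst]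
    rw [map_mul, act_linearForm_mul, ih, act_linearForm_mul, map_add, map_mul, map_mul,
      linearSubst_X, hX, hC, act_linearForm_linearForm, Matrix.mulVec, dotProduct_comm]

theorem exists_matrix_of_isCoordinates {y : Fin N → MvPolynomial (Fin N) k}
    (hy : IsCoordinates y) :
    ∃ M : Matrix (Fin N) (Fin N) k, IsUnit M ∧ ∀ i, y i = linearForm (M i) := by
  choose M hM using fun i => exists_eq_linearForm (hy.1 i)
  refine ⟨Matrix.of M, Matrix.linearIndependent_rows_iff_isUnit.1 ?_, hM⟩
  apply LinearIndependent.of_comp linearForm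
  convert hy.2 using 1
  exact funext fun i => (hM i).symm

theorem isCoordinates_linearForm {M : Matrix (Fin N) (Fin N) k} (hM : IsUnit M) :
    IsCoordinates fun i => linearForm (M i) :=
  ⟨fun _ => isHomogeneous_linearForm _, (Matrix.linearIndependent_rows_iff_isUnit.2 hM).map'
    linearForm (LinearMap.ker_eq_bot.2 linearForm_injective)⟩

theorem notMem_vars_of_pderiv_eq_zero [CharZero k] {p : MvPolynomial (Fin N) k} {i : Fin N}
    (h : pderiv i p = 0) : i ∉ p.vars := by
  classical
  rw [mem_vars_iff_mem_support]
  rintro ⟨d, hd, hi⟩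
  have h1 := coeff_pderiv (i := i) p (d - Finsupp.single i 1)
  have hle : Finsupp.single i 1 ≤ d := by
    rw [Finsupp.single_le_iff]
    exact Nat.one_le_iff_ne_zero.2 (Finsupp.mem_support_iff.1 hi)
  rw [h, coeff_zero, tsub_add_cancel_of_le hle] at h1
  rcases mul_eq_zero.1 h1.symm with h2 | h2
  · exact mem_support_iff.1 hd h2
  · exact Nat.cast_add_one_ne_zero _ h2

/-- A form killed by the derivative along the last coordinate axis only involves the other
coordinates. -/
theorem exists_eq_aeval_of_act_eq_zero [CharZero k] {M : Matrix (Fin (N + 1)) (Fin (N + 1)) k}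
    (hM : IsUnit M) {u : Fin (N + 1) → k} {c : k} (hc : c ≠ 0)
    (hu : M *ᵥ u = Pi.single (Fin.last N) c) {n : ℕ} {f : MvPolynomial (Fin (N + 1)) k}
    (hf : f.IsHomogeneous n) (h : act (linearForm u) f = 0) :
    ∃ q : MvPolynomial (Fin N) k, q.IsHomogeneous n ∧
      f = aeval (fun j : Fin N => linearForm (M j.castSucc)) q := by
  obtain ⟨p, hp, rfl⟩ := exists_linearSubst_eq hM hf
  rw [act_linearForm_linearSubst, hu, ← map_zero (linearSubst M)] at h
  have h1 := linearSubst_injective hM h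
  have h2 : pderiv (Fin.last N) p = 0 := by
    have h3 : Pi.single (Fin.last N) c = c • (Pi.single (Fin.last N) 1 : Fin (N + 1) → k) := by
      rw [← Pi.single_smul, smul_eq_mul, mul_one]
    rw [h3, map_smul, linearForm_single, map_smul, LinearMap.smul_apply, act_X] at h1
    exact (smul_eq_zero.1 h1).resolve_left hc
  have hvars := notMem_vars_of_pderiv_eq_zero h2
  obtain ⟨q, rfl⟩ := exists_rename_eq_of_vars_subset_range p Fin.castSucc
    (Fin.castSucc_injective N) (fun i hi => by
      induction i using Fin.lastCases with
      | last => exact absurd hi hvars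
      | cast j => exact ⟨j, rfl⟩)
  exact ⟨q, (IsHomogeneous.rename_isHomogeneous_iff (Fin.castSucc_injective N)).1 hp,
    aeval_rename _ _ _⟩

/-- Linear forms in coordinates adapted to a vector. -/
theorem exists_adapted_rows {u L v : Fin 4 → k} (hL : L ≠ 0) (hLu : L ⬝ᵥ u = 0)
    (hv : v ⬝ᵥ u ≠ 0) :
    ∃ M : Matrix (Fin 4) (Fin 4) k, IsUnit M ∧ M 2 = L ∧ M 3 = v ∧ M 0 ⬝ᵥ u = 0 ∧
      M 1 ⬝ᵥ u = 0 := by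
  let e : (Fin 4 → k) →ₗ[k] k := Fintype.linearCombination k u
  have he : ∀ a, e a = a ⬝ᵥ u := fun a => rfl
  have hrk : Module.finrank k (LinearMap.ker e) = 3 := by
    have h1 := LinearMap.finrank_range_add_finrank_ker e
    have h2 : LinearMap.range e = ⊤ :=
      LinearMap.range_eq_top.2 (LinearMap.surjective (fun h => hv (by rw [← he, h]; rfl)))
    rw [h2, finrank_top, Module.finrank_self, Module.finrank_fin_fun] at h1
    omega
  let w : Fin 1 → LinearMap.ker e := fun _ => ⟨L, hLu⟩
  have hw : LinearIndependent k w :=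
    LinearIndependent.of_subsingleton 0 fun h => hL (congrArg Subtype.val h)
  obtain ⟨a, ha⟩ := exists_linearIndependent_cons_of_lt_finrank hw (by omega)
  obtain ⟨b, hb⟩ := exists_linearIndependent_cons_of_lt_finrank ha (by omega)
  have hli := hb.map' (LinearMap.ker e).subtype (Submodule.ker_subtype _)
  have hvn : v ∉ Submodule.span k (Set.range ((LinearMap.ker e).subtype ∘
      Fin.cons b (Fin.cons a w : Fin 2 → LinearMap.ker e))) := by
    intro hmem
    refine hv (?_ : v ∈ LinearMap.ker e)
    refine Submodule.span_le.2 ?_ hmem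
    rintro _ ⟨i, rfl⟩
    exact Subtype.property _
  -- The rows are `b, a, L, v`: a basis of the annihilator of `u`, then `v` outside it.
  have hM := linearIndependent_finSnoc.2 ⟨hli, hvn⟩
  refine ⟨_, Matrix.linearIndependent_rows_iff_isUnit.1 hM, ?_, ?_, ?_, ?_⟩
  · rfl
  · rfl
  · exact b.2
  · exact a.2

end Substitution

/-! ### From `h` to a derivative that is a square. -/

section RankOneDerivative

variable {k : Type*} [Field k] {N : ℕ}

/-- The trilinear form of third derivatives of `g` along the vectors of `W`. -/
noncomputable def trilinearForm (g : MvPolynomial (Fin N) k) (W : Submodule k (Fin N → k)) :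
    W →ₗ[k] W →ₗ[k] W →ₗ[k] k :=
  let l : W →ₗ[k] MvPolynomial (Fin N) k := linearForm ∘ₗ W.subtype
  let e : MvPolynomial (Fin N) k →ₗ[k] k :=
    lcoeff k 0 ∘ₗ act.flip g
  ((LinearMap.mul k (MvPolynomial (Fin N) k)).compl₁₂ l l).compr₂
    (((LinearMap.mul k (MvPolynomial (Fin N) k)).compr₂ e).compl₂ l)

theorem trilinearForm_apply (g : MvPolynomial (Fin N) k) (W : Submodule k (Fin N → k))
    (u v w : W) : trilinearForm g W u v w = constantCoeff
      (act (linearForm u) (act (linearForm v) (act (linearForm w) g))) := by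
  rw [← act_mul, ← act_mul]
  simp [trilinearForm, constantCoeff_eq]

variable [CharZero k]

theorem eq_smul_of_act_linearForm_eq {n : ℕ} (hn : n ≠ 0) {g h : MvPolynomial (Fin N) k}
    (hg : g.IsHomogeneous n) (hh : h.IsHomogeneous n) {c : k}
    (H : ∀ v, act (linearForm v) h = c • act (linearForm v) g) : h = c • g := by
  have hcg : (c • g).IsHomogeneous n := by
    rw [smul_eq_C_mul]
    exact hg.C_mul c
  refine eq_of_pderiv_eq hn hh hcg fun i => ?_
  rw [← act_X, ← act_X, map_smul, ← linearForm_single, H]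

theorem eq_smul_linearForm_sq {q : MvPolynomial (Fin N) k} (hq : q.IsHomogeneous 2)
    {b : Fin N → k} (H : ∀ i j, constantCoeff (pderiv i (pderiv j q)) = b i * b j) :
    (2 : k) • q = linearForm b ^ 2 := by
  have h2 : ((2 : k) • q).IsHomogeneous 2 := by
    rw [smul_eq_C_mul]
    exact hq.C_mul 2
  have hb := (isHomogeneous_linearForm b).pow 2
  rw [one_mul] at hb
  refine eq_of_pderiv_eq two_ne_zero h2 hb fun j => ?_
  refine eq_of_pderiv_eq one_ne_zero h2.pderiv hb.pderiv fun i => ?_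
  have h0 : (pderiv i (pderiv j q)).IsHomogeneous 0 := hq.pderiv.pderiv
  rw [← totalDegree_zero_iff_isHomogeneous, totalDegree_eq_zero_iff_eq_C, ← constantCoeff_eq,
    H] at h0
  have h1 : pderiv j (linearForm b ^ 2) = C (2 * b j) * linearForm b := by
    rw [pderiv_pow, pderiv_linearForm, map_mul, map_ofNat]
    simp
    ring
  rw [Derivation.map_smul, Derivation.map_smul, h0, h1, pderiv_C_mul, pderiv_linearForm,
    smul_eq_C_mul, ← C_mul, ← C_mul]
  congr 1
  ring

/-- If some cubic that is not a multiple of `g` has all its derivatives among those of `g`, then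
some derivative of `g` is the square of a nonzero linear form. -/
theorem exists_derivative_eq_sq [IsAlgClosed k] (hN : N ≤ 4) {g h : MvPolynomial (Fin N) k}
    (hg : g.IsHomogeneous 3) (hh : h.IsHomogeneous 3) (hspan : h ∉ Submodule.span k {g})
    (hd : ∀ i, ∃ a, pderiv i h = act (linearForm a) g) :
    ∃ u b : Fin N → k, b ≠ 0 ∧ act (linearForm u) g = linearForm b ^ 2 := by
  choose a ha using hd
  let D : (Fin N → k) →ₗ[k] MvPolynomial (Fin N) k := act.flip g ∘ₗ linearForm
  have hD : ∀ v, D v = act (linearForm v) g := fun _ => rfl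
  let A₀ : (Fin N → k) →ₗ[k] (Fin N → k) := Fintype.linearCombination k a
  have hA₀ : ∀ v, act (linearForm v) h = act (linearForm (A₀ v)) g := by
    intro v
    rw [← hD, Fintype.linearCombination_apply, map_sum, act_linearForm]
    refine Finset.sum_congr rfl fun i _ => ?_
    rw [map_smul, hD, ha]
  -- On a complement of the vectors killing `g`, a nonzero `u` gives a nonzero `∂_u g`.
  obtain ⟨W, hW⟩ := (LinearMap.ker D).exists_isCompl
  let P : (Fin N → k) →ₗ[k] W := W.projectionOnto (LinearMap.ker D) hW.symm
  have hPW : ∀ w : W, P w = w := fun w => Submodule.projectionOnto_apply_left hW.symm w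
  have hP : ∀ v, act (linearForm (P v)) g = act (linearForm v) g := by
    intro v
    have h1 : v - (P v : Fin N → k) ∈ LinearMap.ker P := by
      rw [LinearMap.mem_ker, map_sub, hPW, sub_self]
    rw [Submodule.ker_projectionOnto, LinearMap.mem_ker, map_sub, sub_eq_zero] at h1
    exact h1.symm
  let A : Module.End k W := P ∘ₗ A₀ ∘ₗ W.subtype
  have hA : ∀ v : W, act (linearForm (A v)) g = act (linearForm v) h := fun v =>
    (hP _).trans (hA₀ _).symm
  have hAq : ∀ (v : W) (q : MvPolynomial (Fin N) k),
      act (linearForm (A v)) (act q g) = act q (act (linearForm v) h) := fun v q => by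
    rw [act_comm, hA]
  obtain ⟨u, L, hu, hL⟩ := exists_contraction_eq_mul
    ((Submodule.finrank_le W).trans (by rwa [Module.finrank_fin_fun])) (trilinearForm g W)
    (fun u v w => by
      rw [trilinearForm_apply, trilinearForm_apply, act_comm (linearForm (v : Fin N → k))]) A
    (fun v w => by
      ext x
      simp only [trilinearForm_apply]
      rw [← act_mul (linearForm (w : Fin N → k)), hAq, hAq]
      simp only [← act_mul]
      congr 3
      ring)
    -- If `A = c`, then `h = c g`: vectors that kill `g` also kill `h`, as `∂_i ∂_v h = ∂_{a i} ∂_v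
    -- g`, so `v` may be replaced by its projection to `W`.
    (fun c hc => by
      apply hspan
      rw [Submodule.mem_span_singleton]
      refine ⟨c, (eq_smul_of_act_linearForm_eq three_ne_zero hg hh fun v => ?_).symm⟩
      have hPh : act (linearForm (P v)) h = act (linearForm v) h := by
        refine eq_of_pderiv_eq two_ne_zero (isHomogeneous_act (isHomogeneous_linearForm _) hh)
          (isHomogeneous_act (isHomogeneous_linearForm _) hh) fun i => ?_
        rw [← act_X, act_comm, act_X, ha, act_comm, hP, act_comm, ← ha, ← act_X, act_comm, act_X]
      rw [← hPh, ← hA, hc]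
      change act (linearForm (c • (P v : Fin N → k))) g = _
      rw [map_smul, map_smul, LinearMap.smul_apply, hP])
  let b : Fin N → k := fun i => L (P (Pi.single i 1))
  have hsq : (2 : k) • act (linearForm u) g = linearForm b ^ 2 := by
    refine eq_smul_linearForm_sq (isHomogeneous_act (isHomogeneous_linearForm _) hg) fun i j => ?_
    rw [← hL, trilinearForm_apply, hP, act_comm (linearForm (P (Pi.single i 1) : Fin N → k)), hP,
      linearForm_single, linearForm_single, ← act_X, ← act_X]
    simp only [← act_mul]
    congr 3
    ring
  -- The factor 2 arises because the Hessian of `b^2` is `2 b_i b_j`.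
  refine ⟨(2 : k) • (u : Fin N → k), b, fun hb => hu ?_, ?_⟩
  · rw [hb, map_zero, zero_pow two_ne_zero] at hsq
    have h1 := (smul_eq_zero.1 hsq).resolve_left two_ne_zero
    have h2 : (u : Fin N → k) ∈ LinearMap.ker D ⊓ W := ⟨h1, u.2⟩
    rw [hW.inf_eq_bot, Submodule.mem_bot] at h2
    exact Subtype.ext h2
  · rw [map_smul, map_smul, LinearMap.smul_apply, hsq]

end RankOneDerivative

/-! ### Normal forms. -/

section NormalForm

open scoped Matrix

variable {k : Type*} [Field k]

theorem cons_linearForm_eq (M : Matrix (Fin 4) (Fin 4) k) :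
    ![linearForm (M 0), linearForm (M 1), linearForm (M 2)] =
      fun j : Fin 3 => linearForm (M j.castSucc) := by
  funext j
  fin_cases j <;> rfl

theorem mulVec_eq_single {M : Matrix (Fin 4) (Fin 4) k} {u : Fin 4 → k} (h0 : M 0 ⬝ᵥ u = 0)
    (h1 : M 1 ⬝ᵥ u = 0) (h2 : M 2 ⬝ᵥ u = 0) :
    M *ᵥ u = Pi.single (Fin.last 3) (M 3 ⬝ᵥ u) := by
  funext j
  fin_cases j
  · exact h0
  · exact h1
  · exact h2
  · rfl

theorem exists_ne_zero_dotProduct_eq_zero (u : Fin 4 → k) : ∃ L : Fin 4 → k, L ≠ 0 ∧ L ⬝ᵥ u = 0 := by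
  by_cases hu : u 1 = 0
  · exact ⟨Pi.single 1 1, by simp, by simp [hu]⟩
  · refine ⟨![u 1, -u 0, 0, 0], fun h => hu (congrFun h 0), ?_⟩
    simp [dotProduct, Fin.sum_univ_four]
    ring

theorem act_linearForm_pow_three (u v : Fin 4 → k) :
    act (linearForm u) (linearForm v ^ 3) = C (3 * (u ⬝ᵥ v)) * linearForm v ^ 2 := by
  rw [show linearForm v ^ 3 = linearForm v * linearForm v * linearForm v by ring,
    act_linearForm_mul, act_linearForm_mul, act_linearForm_linearForm, map_mul, map_ofNat]
  ring

variable [CharZero k]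

/-- The derivatives of `h` are multiples of the squared linear form, and equality of mixed partials
makes the factors proportional to `v`. This excludes pure cubes `g`, for which the residual cubic
could be zero. -/
theorem mem_span_cube {v : Fin 4 → k} {h : MvPolynomial (Fin 4) k} (hh : h.IsHomogeneous 3)
    (hd : ∀ i, ∃ a, pderiv i h = act (linearForm a) (linearForm v ^ 3)) :
    h ∈ Submodule.span k {linearForm v ^ 3} := by
  choose a ha using hd
  simp only [act_linearForm_pow_three] at ha
  have hv3 := (isHomogeneous_linearForm v).pow 3
  rw [one_mul] at hv3
  by_cases hv : v = 0
  · have : h = 0 := eq_of_pderiv_eq three_ne_zero hh (isHomogeneous_zero _ _ _) fun i => by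
      rw [ha, hv]
      simp
    rw [this]
    exact Submodule.zero_mem _
  obtain ⟨j, hj⟩ := Function.ne_iff.1 hv
  have hl : linearForm v ≠ 0 := fun h0 => hv (linearForm_injective (h0.trans (map_zero _).symm))
  have hsymm : ∀ i, (a i ⬝ᵥ v) * v j = (a j ⬝ᵥ v) * v i := by
    intro i
    have h1 : pderiv j (pderiv i h) = pderiv i (pderiv j h) := by
      rw [← act_X, ← act_X, act_comm, act_X, act_X]
    rw [ha, ha, pderiv_C_mul, pderiv_C_mul, pderiv_pow, pderiv_pow, pderiv_linearForm,
      pderiv_linearForm] at h1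
    have h2 : C (6 * ((a i ⬝ᵥ v) * v j)) * linearForm v = C (6 * ((a j ⬝ᵥ v) * v i)) * linearForm v := by
      simp only [map_mul, map_ofNat] at h1 ⊢
      linear_combination h1
    exact mul_left_cancel₀ (by norm_num) (C_injective _ _ (mul_right_cancel₀ hl h2))
  rw [Submodule.mem_span_singleton]
  refine ⟨(a j ⬝ᵥ v) / v j, ?_⟩
  refine (eq_of_pderiv_eq three_ne_zero hh ?_ fun i => ?_).symm
  · rw [smul_eq_C_mul]
    exact hv3.C_mul _
  · rw [ha, ← act_X, map_smul, ← linearForm_single, act_linearForm_pow_three,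
      single_one_dotProduct, smul_eq_C_mul, ← mul_assoc, ← C_mul]
    congr 2
    have := hsymm i
    have hj' : v j ≠ 0 := hj
    field_simp
    exact this

/-- The two normal forms of a cubic in four variables, one of whose derivatives is a square. -/
def HasNormalForm (g : MvPolynomial (Fin 4) k) : Prop :=
  ∃ gh : MvPolynomial (Fin 3) k, gh ≠ 0 ∧ gh.IsHomogeneous 3 ∧
    ∃ y : Fin 4 → MvPolynomial (Fin 4) k, IsCoordinates y ∧
      (g = y 3 ^ 3 + aeval ![y 0, y 1, y 2] gh ∨ g = y 2 ^ 2 * y 3 + aeval ![y 0, y 1, y 2] gh)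

theorem hasNormalForm_of_derivative_eq_sq [IsAlgClosed k] {g : MvPolynomial (Fin 4) k}
    (hg : g.IsHomogeneous 3) (hcube : ∀ v, g ≠ linearForm v ^ 3) {u b : Fin 4 → k} (hb : b ≠ 0)
    (hub : act (linearForm u) g = linearForm b ^ 2) : HasNormalForm g := by
  by_cases hbu : b ⬝ᵥ u = 0
  · have hu : u ≠ 0 := by
      rintro rfl
      rw [map_zero, map_zero, LinearMap.zero_apply] at hub
      have h0 := pow_eq_zero_iff two_ne_zero |>.1 hub.symm
      exact hb (linearForm_injective (h0.trans (map_zero _).symm))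
    obtain ⟨v, hvu, hgv⟩ : ∃ v, v ⬝ᵥ u = 1 ∧ g ≠ linearForm b ^ 2 * linearForm v := by
      obtain ⟨i, hi⟩ := Function.ne_iff.1 hu
      have hvu : Pi.single i (u i)⁻¹ ⬝ᵥ u = 1 := by
        rw [single_dotProduct]
        exact inv_mul_cancel₀ hi
      by_cases hgv : g = linearForm b ^ 2 * linearForm (Pi.single i (u i)⁻¹)
      -- Subtracting `b` keeps the value 1 at `u`, because `b` vanishes there, and leaves the
      -- nonzero residue `b^3`.
      · refine ⟨Pi.single i (u i)⁻¹ - b, by rw [sub_dotProduct, hvu, hbu, sub_zero], fun h => ?_⟩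
        rw [hgv, map_sub, mul_sub] at h
        have h0 : linearForm b ^ 3 = 0 := by linear_combination h
        have h1 := pow_eq_zero_iff three_ne_zero |>.1 h0
        exact hb (linearForm_injective (h1.trans (map_zero _).symm))
      · exact ⟨_, hvu, hgv⟩
    obtain ⟨M, hM, h2, h3, h0, h1⟩ := exists_adapted_rows hb hbu (hvu ▸ one_ne_zero)
    have hMu := mulVec_eq_single h0 h1 (h2 ▸ hbu)
    rw [h3, hvu] at hMu
    have hf : (g - linearForm b ^ 2 * linearForm v).IsHomogeneous 3 :=
      hg.sub (((isHomogeneous_linearForm b).pow 2).mul (isHomogeneous_linearForm v))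
    obtain ⟨q, hq, hgq⟩ := exists_eq_aeval_of_act_eq_zero hM one_ne_zero hMu hf (by
      rw [map_sub, hub, act_linearForm_mul, sq, act_linearForm_mul, act_linearForm_linearForm,
        act_linearForm_linearForm, dotProduct_comm, hbu, dotProduct_comm, hvu]
      simp)
    refine ⟨q, ?_, hq, _, isCoordinates_linearForm hM, Or.inr ?_⟩
    · rintro rfl
      rw [map_zero, sub_eq_zero] at hgq
      exact hgv hgq
    · rw [cons_linearForm_eq, ← hgq, h2, h3]
      ring
  -- The scale `s` is chosen so that `∂_u (s b)^3 = 3 s^3 (b ⬝ᵥ u) b^2 = b^2`.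
  · obtain ⟨s, hs⟩ := IsAlgClosed.exists_pow_nat_eq (3 * (b ⬝ᵥ u))⁻¹ (n := 3) (by norm_num)
    have h3bu : 3 * (b ⬝ᵥ u) ≠ 0 := mul_ne_zero three_ne_zero hbu
    have hs0 : s ≠ 0 := by
      rintro rfl
      rw [zero_pow three_ne_zero] at hs
      exact inv_ne_zero h3bu hs.symm
    have hvu : (s • b) ⬝ᵥ u ≠ 0 := by
      rw [smul_dotProduct]
      exact mul_ne_zero hs0 hbu
    -- Any `L` will do: it only fills row 2 of the coordinate matrix.
    obtain ⟨L, hL, hLu⟩ := exists_ne_zero_dotProduct_eq_zero u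
    obtain ⟨M, hM, h2, h3, h0, h1⟩ := exists_adapted_rows hL hLu hvu
    have hMu := mulVec_eq_single h0 h1 (h2 ▸ hLu)
    rw [h3] at hMu
    have hf : (g - linearForm (s • b) ^ 3).IsHomogeneous 3 :=
      hg.sub ((isHomogeneous_linearForm (s • b)).pow 3)
    obtain ⟨q, hq, hgq⟩ := exists_eq_aeval_of_act_eq_zero hM hvu hMu hf (by
      have h4 : 3 * (u ⬝ᵥ (s • b)) * s ^ 2 = 1 := by
        rw [dotProduct_smul, dotProduct_comm, smul_eq_mul]
        have h5 := mul_inv_cancel₀ h3bu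
        rw [← hs] at h5
        linear_combination h5
      rw [map_sub, hub, act_linearForm_pow_three, map_smul, smul_eq_C_mul, mul_pow, ← mul_assoc,
        ← C_pow, ← C_mul, h4, C_1, one_mul, sub_self])
    refine ⟨q, ?_, hq, _, isCoordinates_linearForm hM, Or.inl ?_⟩
    · rintro rfl
      rw [map_zero, sub_eq_zero] at hgq
      exact hcube _ hgq
    · rw [cons_linearForm_eq, ← hgq, h3]
      ring

theorem exists_cubic_of_hasNormalForm {g : MvPolynomial (Fin 4) k} (hg : HasNormalForm g) :
    ∃ h : MvPolynomial (Fin 4) k, h.IsHomogeneous 3 ∧ h ∉ Submodule.span k {g} ∧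
      ∀ i, ∃ a, pderiv i h = act (linearForm a) g := by
  obtain ⟨gh, hgh0, -, y, hy, hgy⟩ := hg
  obtain ⟨M, hM, hyM⟩ := exists_matrix_of_isCoordinates hy
  obtain ⟨M', hM'⟩ := hM.exists_right_inv
  -- The vector dual to `y 3`, so that `∂_u` kills the part in `y 0, y 1, y 2`.
  set u : Fin 4 → k := M' *ᵥ Pi.single (Fin.last 3) 1 with hu
  have hMu : M *ᵥ u = Pi.single (Fin.last 3) 1 := by
    rw [hu, Matrix.mulVec_mulVec, hM', Matrix.one_mulVec]
  have hrow : ∀ j, u ⬝ᵥ M j = if j = Fin.last 3 then 1 else 0 := by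
    intro j
    rw [dotProduct_comm]
    exact (congrFun hMu j).trans (Pi.single_apply _ _ _)
  have hsub : aeval ![y 0, y 1, y 2] gh = linearSubst M (rename Fin.castSucc gh) := by
    rw [hyM, hyM, hyM, cons_linearForm_eq, linearSubst, aeval_rename]
    rfl
  have hact : act (linearForm u) (aeval ![y 0, y 1, y 2] gh) = 0 := by
    rw [hsub, act_linearForm_linearSubst, hMu, linearForm_single, act_X,
      pderiv_eq_zero_of_notMem_vars, map_zero]
    intro hmem
    obtain ⟨j, -, hj⟩ := mem_vars_rename _ _ hmem
    exact (Fin.castSucc_lt_last j).ne hj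
  have hne : aeval ![y 0, y 1, y 2] gh ≠ 0 := by
    rw [hsub]
    intro h
    apply hgh0
    apply rename_injective _ (Fin.castSucc_injective 3)
    apply linearSubst_injective hM
    rw [h, map_zero, map_zero]
  have hy0 : ∀ j, linearForm (M j) ≠ 0 := fun j => hyM j ▸ hy.2.ne_zero j
  have hder : ∀ j, act (linearForm u) g = C (3 : k) * linearForm (M j) ^ 2 ∨
      act (linearForm u) g = linearForm (M j) ^ 2 →
      ∀ i, ∃ a, pderiv i (linearForm (M j) ^ 3) = act (linearForm a) g := by
    intro j hj i
    have h1 : pderiv i (linearForm (M j) ^ 3) = C (3 * M j i) * linearForm (M j) ^ 2 := by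
      rw [← act_X, ← linearForm_single, act_linearForm_pow_three, single_one_dotProduct]
    rcases hj with hj | hj
    · refine ⟨M j i • u, ?_⟩
      rw [h1, map_smul, map_smul, LinearMap.smul_apply, hj, smul_eq_C_mul, ← mul_assoc, ← C_mul,
        mul_comm 3]
    · refine ⟨(3 * M j i) • u, ?_⟩
      rw [h1, map_smul, map_smul, LinearMap.smul_apply, hj, smul_eq_C_mul]
  have hcube : ∀ j, (linearForm (M j) ^ 3).IsHomogeneous 3 := fun j =>
    (isHomogeneous_linearForm (M j)).pow 3
  rcases hgy with hgy | hgy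
  · have hgu : act (linearForm u) g = C 3 * linearForm (M 3) ^ 2 := by
      rw [hgy, map_add, hact, add_zero, hyM, act_linearForm_pow_three, hrow]
      simp
    refine ⟨linearForm (M 3) ^ 3, hcube 3, fun hspan => ?_, hder 3 (Or.inl hgu)⟩
    -- Differentiating along `u` forces `c = 1`, hence a zero residual cubic. In the other normal
    -- form it forces `c = 0`, hence `y 2 ^ 3 = 0`.
    obtain ⟨c, hc⟩ := Submodule.mem_span_singleton.1 hspan
    have h1 := congrArg (act (linearForm u)) hc
    rw [map_smul, hgu, act_linearForm_pow_three, hrow, smul_eq_C_mul] at h1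
    have h2 : C c * (C 3 * linearForm (M 3) ^ 2) = 1 * (C 3 * linearForm (M 3) ^ 2) := by
      rw [h1]
      simp
    have h3 : C c = (1 : MvPolynomial (Fin 4) k) := mul_right_cancel₀
      (mul_ne_zero (C_ne_zero.2 three_ne_zero) (pow_ne_zero 2 (hy0 3))) h2
    rw [smul_eq_C_mul, h3, one_mul, hgy, hyM 3] at hc
    exact hne (by linear_combination hc)
  · have hgu : act (linearForm u) g = linearForm (M 2) ^ 2 := by
      rw [hgy, map_add, hact, add_zero, hyM 2, hyM 3, act_linearForm_mul, sq, act_linearForm_mul,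
        act_linearForm_linearForm, act_linearForm_linearForm, hrow, hrow]
      simp
    refine ⟨linearForm (M 2) ^ 3, hcube 2, fun hspan => ?_, hder 2 (Or.inr hgu)⟩
    obtain ⟨c, hc⟩ := Submodule.mem_span_singleton.1 hspan
    have h1 := congrArg (act (linearForm u)) hc
    rw [map_smul, hgu, act_linearForm_pow_three, hrow, if_neg (by decide), mul_zero, C_0, zero_mul,
      smul_eq_zero] at h1
    have hc0 := h1.resolve_right (pow_ne_zero 2 (hy0 2))
    rw [hc0, zero_smul] at hc
    exact pow_ne_zero 3 (hy0 2) hc.symm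

end NormalForm

end Apolarity

theorem lemma5p8 {k : Type*} [Field k] [IsAlgClosed k] [CharZero k]
    (g : MvPolynomial (Fin 4) k) (hg : g.IsHomogeneous 3) :
    Apolarity.HasMinimalGeneratorInDegree (Apolarity.perp g) 3 ↔
      ∃ gh : MvPolynomial (Fin 3) k, gh ≠ 0 ∧ gh.IsHomogeneous 3 ∧
        ∃ y : Fin 4 → MvPolynomial (Fin 4) k, Apolarity.IsCoordinates y ∧
          (g = y 3 ^ 3 + MvPolynomial.aeval ![y 0, y 1, y 2] gh ∨
            g = y 2 ^ 2 * y 3 + MvPolynomial.aeval ![y 0, y 1, y 2] gh) := by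
  rw [Apolarity.hasMinimalGeneratorInDegree_three_iff hg]
  constructor
  · rintro ⟨h, hh, hspan, hd⟩
    obtain ⟨u, b, hb, hub⟩ := Apolarity.exists_derivative_eq_sq le_rfl hg hh hspan hd
    refine Apolarity.hasNormalForm_of_derivative_eq_sq hg (fun v hv => hspan ?_) hb hub
    subst hv
    exact Apolarity.mem_span_cube hh hd
  · exact Apolarity.exists_cubic_of_hasNormalForm
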